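/- Let $T_n$ and $U_n$ denote the Chebyshev polynomials of the first and second kind, normalized by $T_n(\cos\theta)=\cos n\theta$ and $U_n(\cos\theta)=\sin((n+1)\theta)/\sin\theta$. Let $\psi=\Gamma'/\Gamma$ be the digamma function, $H_n=\sum_{k=1}^n \frac1k$ (with $H_0=0$), and $\binom{y}{n}=\frac{1}{n!}\,y(y-1)\cdots(y-n+1)$ for real $y$. For an integer $\ell\ge 0$ put $$P_1(u,\ell)=\prod_{j=1}^{\ell-1}(u^2+j^2)\quad(\ell\ge1),\qquad P_2(u,\ell)=\prod_{j=1}^{\ell}\left(u^2+\left(j-\tfrac12\right)^2\right),$$ where empty products are equal to $1$. Then both integrals below converge absolutely and have the following values. (1) For every integer $\ell\ge 1$ and every real $x>\ell$, $$\int_0^\infty\left\{\frac{uP_1(u,\ell)}{\tanh(\pi u)}-u^{2\ell-1}\right\}T_{2\ell}\!\left(\frac{x-\ell}{\sqrt{u^2+(x-\ell)^2}}\right)\frac{du}{(u^2+(x-\ell)^2)^{\ell}}=(-1)^\ell\left(\log(x-\ell)+H_{2\ell-1}-\frac{d^{2\ell-1}}{dx^{2\ell-1}}\left\{\binom{x-1}{2\ell-1}\psi(x-\ell)\right\}\right).$$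 (2) For every integer $\ell\ge 0$ and every real $x>\ell+\tfrac12$, $$\int_0^\infty\left\{\tanh(\pi u)P_2(u,\ell)-u^{2\ell}\right\}U_{2\ell}\!\left(\frac{x-\ell-\frac12}{\sqrt{u^2+(x-\ell-\frac12)^2}}\right)\frac{u\,du}{(u^2+(x-\ell-\frac12)^2)^{\ell+1}}=(-1)^\ell\left(\log\left(x-\ell-\tfrac12\right)+H_{2\ell}-\frac{d^{2\ell}}{dx^{2\ell}}\left\{\binom{x-1}{2\ell}\psi(x-\ell)\right\}\right).$$ -/

import Mathlib

namespace ChebyshevIntegrals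

noncomputable section

/-- The digamma function of a real variable, `ψ(x) = Γ'(x) / Γ(x)`. -/
def digamma (x : ℝ) : ℝ := deriv Real.Gamma x / Real.Gamma x

/-- `P₁(u, ℓ) = ∏_{j=1}^{ℓ-1} (u² + j²)`. -/
def P₁ (u : ℝ) (ℓ : ℕ) : ℝ := ∏ j ∈ Finset.Icc 1 (ℓ - 1), (u ^ 2 + (j : ℝ) ^ 2)

/-- `P₂(u, ℓ) = ∏_{j=1}^{ℓ} (u² + (j - 1/2)²)`. -/
def P₂ (u : ℝ) (ℓ : ℕ) : ℝ := ∏ j ∈ Finset.Icc 1 ℓ, (u ^ 2 + ((j : ℝ) - 1 / 2) ^ 2)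

/-- The integrand of the first formula, with the Chebyshev polynomial of the first kind. -/
def integrandT (ℓ : ℕ) (x u : ℝ) : ℝ :=
  (u * P₁ u ℓ / Real.tanh (Real.pi * u) - u ^ (2 * ℓ - 1)) *
    (Polynomial.Chebyshev.T ℝ (2 * (ℓ : ℤ))).eval
      ((x - ℓ) / Real.sqrt (u ^ 2 + (x - ℓ) ^ 2)) /
    (u ^ 2 + (x - ℓ) ^ 2) ^ ℓ

/-- The integrand of the second formula, with the Chebyshev polynomial of the second kind
(normalized by `U_n (cos θ) = sin ((n + 1) θ) / sin θ`). -/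
def integrandU (ℓ : ℕ) (x u : ℝ) : ℝ :=
  (Real.tanh (Real.pi * u) * P₂ u ℓ - u ^ (2 * ℓ)) *
    (Polynomial.Chebyshev.U ℝ (2 * (ℓ : ℤ))).eval
      ((x - ℓ - 1 / 2) / Real.sqrt (u ^ 2 + (x - ℓ - 1 / 2) ^ 2)) *
    u / (u ^ 2 + (x - ℓ - 1 / 2) ^ 2) ^ (ℓ + 1)

end

end ChebyshevIntegrals

open MeasureTheory Set Filter Topology

namespace ChebyshevIntegrals

/-! Put a = x - ℓ (or x - ℓ - 1/2), z = a + iu and n = 2ℓ - 1 (or 2ℓ). In polar form the Chebyshev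
factors are Re z^(-2ℓ) and -Im z^(-(2ℓ+1)), which are, up to constants and powers of i, the n-th
a-derivative of the simple pole 1/z. Both formulas thus come from differentiating n times the
integrals K_w(a) = ∫ (u/(u²+1) - w(u) u/(u²+a²)) du, where u/(u²+a²) = -Im(1/z) and u/(u²+1) secures
convergence.

For M monic of degree n, M(a)/z is a polynomial in a of degree n - 1 plus M(-iu)/z, since z vanishes
at a = -iu. Hence the n-th derivative of M(a)/n! · K_w(a) is the integral of u/(u²+1) + w(u)
Im((-1)^n M(-iu)/z^(n+1)) (`iteratedDeriv_monic_mul_kernelIntegral`). With w = 1 and M = X^n this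
gives log a + H_n. With w = coth(πu) or tanh(πu) and M the shifted falling factorial, M(-iu)
produces P₁ or P₂, and the result is the derivative of the binomial times ψ. In the difference the
terms u/(u²+1) cancel.

It remains to know K_w: log a for w = 1, ψ(a) + 1/(2a) for coth (`kernelIntegral_coth`), ψ(a + 1/2)
for tanh (`kernelIntegral_tanh`). -/

/-! ### Differentiation of the kernel integrals under the integral sign -/

/-- The `k`-th derivative of `u / (u² + a²)` with respect to `a`, written through the simple pole
`1 / (a + iu)`. -/
noncomputable def poleDeriv (k : ℕ) (a u : ℝ) : ℝ :=
  -((-1) ^ k * k.factorial * ((((a : ℂ) + u * Complex.I) ^ (k + 1))⁻¹).im)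

/-- The `k`-th derivative of `u / (u² + 1) - w(u) u / (u² + a²)` with respect to `a`. -/
noncomputable def kernel (w : ℝ → ℝ) (k : ℕ) (a u : ℝ) : ℝ :=
  (if k = 0 then u / (u ^ 2 + 1) else 0) - w u * poleDeriv k a u

/-- `∫₀^∞ (u / (u² + 1) - w(u) u / (u² + a²)) du`. -/
noncomputable def kernelIntegral (w : ℝ → ℝ) (a : ℝ) : ℝ :=
  ∫ u in Ioi (0 : ℝ), kernel w 0 a u

lemma ofReal_add_mul_I_ne_zero {a : ℝ} (ha : 0 < a) (u : ℝ) : (a : ℂ) + u * Complex.I ≠ 0 := by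
  intro h
  have := congrArg Complex.re h
  simp at this
  exact ha.ne' this

lemma norm_sq_add_mul_I (a u : ℝ) : ‖(a : ℂ) + u * Complex.I‖ ^ 2 = u ^ 2 + a ^ 2 := by
  rw [← Complex.normSq_eq_norm_sq, Complex.normSq_add_mul_I]; ring

lemma poleDeriv_zero (a u : ℝ) : poleDeriv 0 a u = u / (u ^ 2 + a ^ 2) := by
  simp [poleDeriv, Complex.inv_im, Complex.normSq_add_mul_I, add_comm, neg_div]

lemma hasDerivAt_poleDeriv (k : ℕ) {a : ℝ} (ha : 0 < a) (u : ℝ) :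
    HasDerivAt (fun b => poleDeriv k b u) (poleDeriv (k + 1) a u) a := by
  have hz := ofReal_add_mul_I_ne_zero ha u
  have h1 : HasDerivAt (fun z : ℂ => ((z + u * Complex.I) ^ (k + 1))⁻¹)
      (-((k + 1 : ℕ) * ((a : ℂ) + u * Complex.I) ^ k) /
        (((a : ℂ) + u * Complex.I) ^ (k + 1)) ^ 2) (a : ℂ) := by
    have := (((hasDerivAt_id (a : ℂ)).add_const (u * Complex.I)).fun_pow (k + 1)).fun_inv
      (pow_ne_zero _ hz)
    simpa using this
  have h2 := h1.comp_ofReal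
  have h3 : HasDerivAt (fun b : ℝ => ((((b : ℂ) + u * Complex.I) ^ (k + 1))⁻¹).im)
      ((-((k + 1 : ℕ) * ((a : ℂ) + u * Complex.I) ^ k) /
        (((a : ℂ) + u * Complex.I) ^ (k + 1)) ^ 2).im) a :=
    Complex.imCLM.hasFDerivAt.comp_hasDerivAt a h2
  have h4 := (h3.const_mul ((-1) ^ k * (k.factorial : ℝ))).fun_neg
  refine h4.congr_deriv ?_
  have : -(((k + 1 : ℕ) : ℂ) * ((a : ℂ) + u * Complex.I) ^ k) /
        (((a : ℂ) + u * Complex.I) ^ (k + 1)) ^ 2 =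
      ((-(k + 1 : ℕ) : ℝ) : ℂ) * (((a : ℂ) + u * Complex.I) ^ (k + 1 + 1))⁻¹ := by
    push_cast
    field_simp
    ring
  rw [this, Complex.im_ofReal_mul, poleDeriv, Nat.factorial_succ]
  push_cast
  ring

/-- Keeping the factor `|z.im|` leaves a factor u in the bound for `poleDeriv`; it absorbs a weight
of size 1/u near 0, such as coth. -/
lemma abs_im_pow_le (z : ℂ) (m : ℕ) : |(z ^ (m + 1)).im| ≤ (m + 1) * |z.im| * ‖z‖ ^ m := by
  induction m with
  | zero => simp
  | succ m ih =>
    rw [pow_succ z (m + 1), Complex.mul_im]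
    have h1 : |(z ^ (m + 1)).re| ≤ ‖z‖ ^ (m + 1) := by
      simpa using Complex.abs_re_le_norm (z ^ (m + 1))
    have h2 : |z.re| ≤ ‖z‖ := Complex.abs_re_le_norm z
    calc |(z ^ (m + 1)).re * z.im + (z ^ (m + 1)).im * z.re|
        ≤ |(z ^ (m + 1)).re| * |z.im| + |(z ^ (m + 1)).im| * |z.re| := by
          rw [← abs_mul, ← abs_mul]; exact abs_add_le _ _
      _ ≤ ‖z‖ ^ (m + 1) * |z.im| + ((m + 1) * |z.im| * ‖z‖ ^ m) * ‖z‖ := by gcongr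
      _ = _ := by push_cast; ring

lemma abs_poleDeriv_le (k : ℕ) {a u : ℝ} (ha : 0 < a) (hu : 0 < u) :
    |poleDeriv k a u| ≤ (k + 1).factorial * (u / ‖(a : ℂ) + u * Complex.I‖ ^ (k + 2)) := by
  set z : ℂ := (a : ℂ) + u * Complex.I with hz
  have hz0 : z ≠ 0 := ofReal_add_mul_I_ne_zero ha u
  have hn : 0 < ‖z‖ := norm_pos_iff.2 hz0
  have h := abs_im_pow_le z⁻¹ k
  have him : |(z⁻¹).im| = u / ‖z‖ ^ 2 := by
    rw [Complex.inv_im, Complex.normSq_eq_norm_sq, abs_div, abs_neg, abs_of_pos (by positivity :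
      0 < ‖z‖ ^ 2)]
    simp [hz, abs_of_pos hu]
  rw [him, norm_inv] at h
  have : |poleDeriv k a u| = k.factorial * |((z⁻¹) ^ (k + 1)).im| := by
    simp [poleDeriv, abs_mul, hz]
  rw [this]
  calc (k.factorial : ℝ) * |((z⁻¹) ^ (k + 1)).im|
      ≤ k.factorial * ((k + 1) * (u / ‖z‖ ^ 2) * ‖z‖⁻¹ ^ k) := by gcongr
    _ = _ := by
      rw [Nat.factorial_succ]; rw [inv_pow]; push_cast; field_simp; ring

lemma hasDerivAt_kernel (w : ℝ → ℝ) (k : ℕ) {a : ℝ} (ha : 0 < a) (u : ℝ) :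
    HasDerivAt (fun b => kernel w k b u) (kernel w (k + 1) a u) a := by
  have := ((hasDerivAt_poleDeriv k ha u).const_mul (w u)).const_sub
    (if k = 0 then u / (u ^ 2 + 1) else 0)
  refine this.congr_deriv ?_
  simp [kernel]

@[fun_prop]
lemma measurable_kernel {w : ℝ → ℝ} (hw : Measurable w) (k : ℕ) (a : ℝ) :
    Measurable (kernel w k a) := by
  unfold kernel poleDeriv
  split_ifs <;> fun_prop

lemma integrable_inv_sq_add_sq {a : ℝ} (ha : 0 < a) :
    Integrable (fun u : ℝ => (u ^ 2 + a ^ 2)⁻¹) := by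
  have h := (integrable_inv_one_add_sq.comp_mul_left' (inv_ne_zero ha.ne')).const_mul ((a ^ 2)⁻¹)
  refine h.congr (Eventually.of_forall fun u => ?_)
  have : 0 < u ^ 2 + a ^ 2 := by positivity
  have : 0 < 1 + (a⁻¹ * u) ^ 2 := by positivity
  simp only
  rw [← mul_inv]
  congr 1
  field_simp
  ring

lemma integral_inv_sq_add_sq {a : ℝ} (ha : 0 < a) :
    ∫ u in Ioi (0 : ℝ), (u ^ 2 + a ^ 2)⁻¹ = Real.pi / (2 * a) := by
  have hd : ∀ u ∈ Ici (0 : ℝ), HasDerivAt (fun u => a⁻¹ * Real.arctan (a⁻¹ * u))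
      ((u ^ 2 + a ^ 2)⁻¹) u := by
    intro u _
    have := (((hasDerivAt_id u).const_mul a⁻¹).arctan).const_mul a⁻¹
    refine this.congr_deriv ?_
    have : 0 < u ^ 2 + a ^ 2 := by positivity
    have : 0 < 1 + (a⁻¹ * u) ^ 2 := by positivity
    simp only [id]
    field_simp
    ring
  have ht : Tendsto (fun u => a⁻¹ * Real.arctan (a⁻¹ * u)) atTop (𝓝 (a⁻¹ * (Real.pi / 2))) := by
    refine Tendsto.const_mul _ ?_
    exact (tendsto_nhds_of_tendsto_nhdsWithin Real.tendsto_arctan_atTop).comp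
      (tendsto_id.const_mul_atTop (inv_pos.2 ha))
  rw [integral_Ioi_of_hasDerivAt_of_tendsto' hd (integrable_inv_sq_add_sq ha).integrableOn ht]
  simp
  field_simp

section

variable {w : ℝ → ℝ} {C : ℝ}

lemma abs_mul_kernel_le (hC : ∀ u, 0 < u → |u * (w u - 1)| ≤ C) {u : ℝ} (hu : 0 < u) :
    |w u| * u ≤ C + u := by
  have h := hC u hu
  have : |w u| * u = |u * (w u - 1) + u| := by
    rw [← abs_of_pos hu, ← abs_mul, abs_of_pos hu]; congr 1; ring
  rw [this]
  exact (abs_add_le _ _).trans (by rw [abs_of_pos hu]; gcongr)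

lemma abs_kernel_zero_le (hC : ∀ u, 0 < u → |u * (w u - 1)| ≤ C) {a u : ℝ} (ha : 0 < a)
    (hu : 0 < u) : |kernel w 0 a u| ≤ (C + |a ^ 2 - 1|) * (u ^ 2 + a ^ 2)⁻¹ := by
  have h1 : 0 < u ^ 2 + a ^ 2 := by positivity
  have h2 : 0 < u ^ 2 + 1 := by positivity
  have : kernel w 0 a u =
      (-(u * (w u - 1)) + (a ^ 2 - 1) * (u / (u ^ 2 + 1))) * (u ^ 2 + a ^ 2)⁻¹ := by
    rw [kernel, poleDeriv_zero, if_pos rfl]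
    field_simp
    ring
  rw [this, abs_mul, abs_of_pos (inv_pos.2 h1)]
  gcongr
  refine (abs_add_le _ _).trans ?_
  rw [abs_neg, abs_mul (a ^ 2 - 1)]
  have h3 : |u / (u ^ 2 + 1)| ≤ 1 := by
    rw [abs_of_pos (by positivity), div_le_one h2]
    nlinarith [sq_nonneg (u - 1)]
  exact add_le_add (hC u hu) (mul_le_of_le_one_right (abs_nonneg _) h3)

lemma integrableOn_kernel_zero (hw : Measurable w) (hC : ∀ u, 0 < u → |u * (w u - 1)| ≤ C)
    {a : ℝ} (ha : 0 < a) : IntegrableOn (kernel w 0 a) (Ioi 0) := by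
  refine Integrable.mono' (((integrable_inv_sq_add_sq ha).const_mul
    (C + |a ^ 2 - 1|)).integrableOn) (measurable_kernel hw 0 a).aestronglyMeasurable ?_
  filter_upwards [ae_restrict_mem measurableSet_Ioi] with u hu
  exact abs_kernel_zero_le hC ha hu

/-- Domination of the derivatives of the kernel, locally uniformly in `a`. -/
lemma abs_kernel_succ_le (hC : ∀ u, 0 < u → |u * (w u - 1)| ≤ C) (k : ℕ) {δ a u : ℝ}
    (hδ : 0 < δ) (ha : δ < a) (hu : 0 < u) :
    |kernel w (k + 1) a u| ≤
      (k + 2).factorial * (C / δ + 1) / δ ^ k * (u ^ 2 + δ ^ 2)⁻¹ := by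
  have ha0 : 0 < a := hδ.trans ha
  have hC0 : 0 ≤ C := (abs_nonneg _).trans (hC u hu)
  have hp := abs_poleDeriv_le (k + 1) ha0 hu
  have hsq := norm_sq_add_mul_I a u
  set r := ‖(a : ℂ) + u * Complex.I‖ with hr
  have hr0 : 0 < r := norm_pos_iff.2 (ofReal_add_mul_I_ne_zero ha0 u)
  have hur : u ≤ r := by nlinarith
  have hδr : δ ≤ r := by nlinarith
  -- |w| u ≤ C + u costs one power of r, so r^(k+3) in the denominator becomes r^k · r²: the first
  -- factor is bounded by δ, the second stays integrable.
  have h1 : C + u ≤ (C / δ + 1) * r := by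
    have : C ≤ C / δ * r := by
      rw [div_mul_eq_mul_div, le_div_iff₀ hδ]; gcongr
    linarith
  have h2 : (r ^ 2)⁻¹ ≤ (u ^ 2 + δ ^ 2)⁻¹ := by
    rw [hsq]; gcongr
  have : |kernel w (k + 1) a u| = |w u| * |poleDeriv (k + 1) a u| := by
    simp [kernel, abs_mul]
  rw [this]
  calc |w u| * |poleDeriv (k + 1) a u|
      ≤ |w u| * ((k + 2).factorial * (u / r ^ (k + 3))) := by gcongr
    _ = (k + 2).factorial * (|w u| * u) / r ^ (k + 3) := by ring
    _ ≤ (k + 2).factorial * ((C / δ + 1) * r) / r ^ (k + 3) := by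
      have := (abs_mul_kernel_le hC hu).trans h1
      gcongr ?_ / _
      exact mul_le_mul_of_nonneg_left this (by positivity)
    _ = (k + 2).factorial * (C / δ + 1) / r ^ k * (r ^ 2)⁻¹ := by
      field_simp
      ring
    _ ≤ _ := by gcongr

lemma integrableOn_kernel_and_hasDerivAt (hw : Measurable w)
    (hC : ∀ u, 0 < u → |u * (w u - 1)| ≤ C) (k : ℕ) {a : ℝ} (ha : 0 < a) :
    IntegrableOn (kernel w k a) (Ioi 0) ∧
      HasDerivAt (fun b => ∫ u in Ioi (0 : ℝ), kernel w k b u)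
        (∫ u in Ioi (0 : ℝ), kernel w (k + 1) a u) a := by
  -- Dominated differentiation also returns integrability of the next derivative, so integrability
  -- for every order follows by induction from order 0.
  have key : ∀ k, IntegrableOn (kernel w k a) (Ioi 0) →
      Integrable (kernel w (k + 1) a) (volume.restrict (Ioi 0)) ∧
      HasDerivAt (fun b => ∫ u in Ioi (0 : ℝ), kernel w k b u)
        (∫ u in Ioi (0 : ℝ), kernel w (k + 1) a u) a := by
    intro k hk
    have hδ : 0 < a / 2 := by positivity
    refine hasDerivAt_integral_of_dominated_loc_of_deriv_le (s := Ioi (a / 2))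
      (bound := fun u => (k + 2).factorial * (C / (a / 2) + 1) / (a / 2) ^ k *
        (u ^ 2 + (a / 2) ^ 2)⁻¹)
      (Ioi_mem_nhds (by linarith)) (Eventually.of_forall fun b =>
        (measurable_kernel hw k b).aestronglyMeasurable) hk
      (measurable_kernel hw (k + 1) a).aestronglyMeasurable ?_
      ((integrable_inv_sq_add_sq hδ).const_mul _).integrableOn ?_
    · filter_upwards [ae_restrict_mem measurableSet_Ioi] with u hu b hb
      exact abs_kernel_succ_le hC k hδ hb hu
    · exact Eventually.of_forall fun u b hb => hasDerivAt_kernel w k (hδ.trans hb) u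
  have hint : ∀ k, IntegrableOn (kernel w k a) (Ioi 0) := by
    intro k
    induction k with
    | zero => exact integrableOn_kernel_zero hw hC ha
    | succ k ih => exact (key k ih).1
  exact ⟨hint k, (key k (hint k)).2⟩

lemma iteratedDeriv_kernelIntegral (hw : Measurable w)
    (hC : ∀ u, 0 < u → |u * (w u - 1)| ≤ C) (k : ℕ) {a : ℝ} (ha : 0 < a) :
    iteratedDeriv k (kernelIntegral w) a = ∫ u in Ioi (0 : ℝ), kernel w k a u := by
  induction k generalizing a with
  | zero => rw [iteratedDeriv_zero]; rfl
  | succ k ih =>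
    rw [iteratedDeriv_succ, ← (integrableOn_kernel_and_hasDerivAt hw hC k ha).2.deriv]
    refine EventuallyEq.deriv_eq ?_
    filter_upwards [Ioi_mem_nhds ha] with b hb using ih hb

lemma contDiffAt_kernelIntegral (hw : Measurable w)
    (hC : ∀ u, 0 < u → |u * (w u - 1)| ≤ C) (n : ℕ) {a : ℝ} (ha : 0 < a) :
    ContDiffAt ℝ n (kernelIntegral w) a := by
  have key : ∀ n k : ℕ,
      ContDiffOn ℝ n (fun b => ∫ u in Ioi (0 : ℝ), kernel w k b u) (Ioi 0) := by
    intro n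
    induction n with
    | zero =>
      intro k
      exact contDiffOn_zero.2 fun b hb =>
        (integrableOn_kernel_and_hasDerivAt hw hC k hb).2.continuousAt.continuousWithinAt
    | succ n ih =>
      intro k
      have : ((n + 1 : ℕ) : WithTop ℕ∞) = (n : WithTop ℕ∞) + 1 := by push_cast; rfl
      rw [this, contDiffOn_succ_iff_deriv_of_isOpen isOpen_Ioi]
      refine ⟨fun b hb => (integrableOn_kernel_and_hasDerivAt hw hC k
        hb).2.differentiableAt.differentiableWithinAt, by simp, (ih (k + 1)).congr fun b hb => ?_⟩
      exact (integrableOn_kernel_and_hasDerivAt hw hC k hb).2.deriv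
  exact (key n 0).contDiffAt (Ioi_mem_nhds ha)

end

/-! ### Leibniz rule for a monic polynomial times a kernel integral -/

lemma contDiff_polynomial_eval (p : Polynomial ℝ) (n : WithTop ℕ∞) :
    ContDiff ℝ n (fun x => p.eval x) := by
  simpa using p.contDiff_aeval (𝕜 := ℝ) n

lemma iteratedDeriv_polynomial_eval (p : Polynomial ℝ) (i : ℕ) :
    iteratedDeriv i (fun x => p.eval x) = fun x => (Polynomial.derivative^[i] p).eval x := by
  induction i with
  | zero => simp
  | succ i ih =>
    rw [iteratedDeriv_succ, ih, Function.iterate_succ_apply']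
    ext x
    exact Polynomial.deriv _

lemma eval_iterate_derivative_eq (p : Polynomial ℝ) (i : ℕ) (a : ℝ) :
    (Polynomial.derivative^[i] p).eval a = i.factorial * (Polynomial.taylor a p).coeff i := by
  rw [Polynomial.taylor_coeff, ← Polynomial.factorial_smul_hasseDeriv]
  simp

/-- This is the Taylor expansion of M at a with increment -z, because -iu = a - z. -/
lemma aeval_neg_mul_I_eq_sum (M : Polynomial ℝ) {n : ℕ} (hn : M.natDegree = n) (a u : ℝ) :
    Polynomial.aeval (-(u * Complex.I)) M = ∑ i ∈ Finset.range (n + 1),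
      ((Polynomial.taylor a M).coeff i : ℂ) * (-((a : ℂ) + u * Complex.I)) ^ i := by
  have h : Polynomial.aeval (-((a : ℂ) + u * Complex.I)) (Polynomial.taylor a M) =
      Polynomial.aeval (-(u * Complex.I)) M := by
    rw [Polynomial.taylor_apply, Polynomial.aeval_comp]
    congr 1
    simp
  rw [← h, Polynomial.aeval_eq_sum_range, Polynomial.natDegree_taylor, hn]
  simp

/-- The integrand of the `n`-th derivative of `M(a) / n!` times a kernel integral. -/
noncomputable def polynomialKernel (M : Polynomial ℝ) (n : ℕ) (w : ℝ → ℝ) (a u : ℝ) : ℝ :=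
  u / (u ^ 2 + 1) + w u * ((-1) ^ n * Polynomial.aeval (-(u * Complex.I)) M *
    (((a : ℂ) + u * Complex.I) ^ (n + 1))⁻¹).im

/-- The right side is the Leibniz sum. Its pole terms are Taylor coefficients of M at a times powers
of z, and they reassemble to M(-iu)/z^(n+1). The term u/(u²+1) occurs only for i = n, with
coefficient 1 because M is monic. -/
lemma polynomialKernel_eq_sum {M : Polynomial ℝ} (hM : M.Monic) {n : ℕ} (hn : M.natDegree = n)
    (w : ℝ → ℝ) {a : ℝ} (ha : 0 < a) (u : ℝ) :
    polynomialKernel M n w a u = ∑ i ∈ Finset.range (n + 1),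
      n.choose i * (i.factorial * (Polynomial.taylor a M).coeff i / n.factorial) *
        kernel w (n - i) a u := by
  set t := (Polynomial.taylor a M).coeff with ht
  set z : ℂ := (a : ℂ) + u * Complex.I with hz
  have hz0 : z ≠ 0 := ofReal_add_mul_I_ne_zero ha u
  have htn : t n = 1 := by
    rw [ht, ← hn, Polynomial.coeff_taylor_natDegree]; exact hM
  have hterm : ∀ i ∈ Finset.range (n + 1),
      n.choose i * (i.factorial * t i / n.factorial) * kernel w (n - i) a u =
        (if n = i then u / (u ^ 2 + 1) else 0) +
          w u * ((((-1) ^ (n - i) * t i : ℝ) : ℂ) * (z ^ (n - i + 1))⁻¹).im := by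
    intro i hi
    have hin : i ≤ n := Nat.lt_succ_iff.1 (Finset.mem_range.1 hi)
    have hc : (n.choose i : ℝ) * i.factorial * (n - i).factorial = n.factorial := by
      exact_mod_cast Nat.choose_mul_factorial_mul_factorial hin
    have hf : ((n - i).factorial : ℝ) ≠ 0 := by positivity
    have hi0 : (i.factorial : ℝ) ≠ 0 := by positivity
    have hc0 : (n.choose i : ℝ) ≠ 0 := by exact_mod_cast (Nat.choose_pos hin).ne'
    have hc' : n.choose i * (i.factorial * t i / n.factorial) = t i / (n - i).factorial := by
      rw [← hc]; field_simp
    rw [hc', Complex.im_ofReal_mul, kernel, poleDeriv]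
    by_cases h : n = i
    · subst h; simp [htn, hz]
    · have : n - i ≠ 0 := by omega
      rw [if_neg h, if_neg this]
      field_simp
      ring
  rw [Finset.sum_congr rfl hterm, Finset.sum_add_distrib, Finset.sum_ite_eq, if_pos (by simp),
    ← Finset.mul_sum, ← Complex.im_sum, polynomialKernel, aeval_neg_mul_I_eq_sum M hn a u,
    Finset.mul_sum, Finset.sum_mul]
  congr 3
  refine Finset.sum_congr rfl fun i hi => ?_
  obtain ⟨j, rfl⟩ := Nat.exists_eq_add_of_le (Nat.lt_succ_iff.1 (Finset.mem_range.1 hi))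
  rw [← hz, Nat.add_sub_cancel_left, show i + j + 1 = i + (j + 1) by ring, pow_add z,
    pow_add (-1 : ℂ), neg_pow z]
  have h1 : ((-1 : ℂ) ^ i) * (-1) ^ i = 1 := by rw [← mul_pow]; simp
  push_cast
  have hzi : z ^ i ≠ 0 := pow_ne_zero _ hz0
  field_simp
  linear_combination (t i : ℂ) * h1

theorem iteratedDeriv_monic_mul_kernelIntegral {M : Polynomial ℝ} (hM : M.Monic) {n : ℕ}
    (hn : M.natDegree = n) {w : ℝ → ℝ} {C : ℝ} (hw : Measurable w)
    (hC : ∀ u, 0 < u → |u * (w u - 1)| ≤ C) {a : ℝ} (ha : 0 < a) :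
    IntegrableOn (polynomialKernel M n w a) (Ioi 0) ∧
    iteratedDeriv n (fun b => M.eval b / n.factorial * kernelIntegral w b) a =
      ∫ u in Ioi (0 : ℝ), polynomialKernel M n w a u := by
  have hterm : ∀ i ∈ Finset.range (n + 1), IntegrableOn (fun u =>
      n.choose i * (i.factorial * (Polynomial.taylor a M).coeff i / n.factorial) *
        kernel w (n - i) a u) (Ioi 0) := fun i _ =>
    (integrableOn_kernel_and_hasDerivAt hw hC (n - i) ha).1.const_mul _
  have hfun : polynomialKernel M n w a = fun u => ∑ i ∈ Finset.range (n + 1),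
      n.choose i * (i.factorial * (Polynomial.taylor a M).coeff i / n.factorial) *
        kernel w (n - i) a u := funext (polynomialKernel_eq_sum hM hn w ha)
  rw [hfun]
  refine ⟨integrable_finsetSum _ hterm, ?_⟩
  rw [integral_finsetSum _ hterm]
  have hp : (fun b => M.eval b / n.factorial) =
      fun b => (Polynomial.C ((n.factorial : ℝ)⁻¹) * M).eval b := by
    ext b; simp; ring
  have hcd : ContDiffAt ℝ n (fun b => M.eval b / n.factorial) a := by
    rw [hp]; exact (contDiff_polynomial_eval _ _).contDiffAt
  rw [iteratedDeriv_fun_mul hcd (contDiffAt_kernelIntegral hw hC n ha)]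
  refine Finset.sum_congr rfl fun i _ => ?_
  rw [integral_const_mul, iteratedDeriv_kernelIntegral hw hC _ ha, hp,
    iteratedDeriv_polynomial_eval, Polynomial.iterate_derivative_C_mul]
  beta_reduce
  rw [Polynomial.eval_C_mul, eval_iterate_derivative_eq]
  ring

lemma iteratedDeriv_polynomial_eval_eq_zero {p : Polynomial ℝ} {n : ℕ} (h : p.natDegree < n)
    (a : ℝ) : iteratedDeriv n (fun x => p.eval x) a = 0 := by
  simp [iteratedDeriv_polynomial_eval, Polynomial.iterate_derivative_eq_zero h]

/-- `dⁿ/daⁿ (aⁿ log a / n!) = log a + Hₙ`. -/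
lemma iteratedDeriv_pow_mul_log (n : ℕ) {a : ℝ} (ha : 0 < a) :
    iteratedDeriv n (fun b => b ^ n / n.factorial * Real.log b) a =
      Real.log a + (harmonic n : ℝ) := by
  induction n generalizing a with
  | zero => simp
  | succ n ih =>
    -- The product rule reproduces the case n plus b^n/((n+1) n!), whose n-th derivative is the new
    -- harmonic term 1/(n+1).
    have hd : deriv (fun b : ℝ => b ^ (n + 1) / (n + 1).factorial * Real.log b) =ᶠ[𝓝 a]
        fun b => b ^ n / n.factorial * Real.log b + (n + 1 : ℝ)⁻¹ * (b ^ n / n.factorial) := by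
      filter_upwards [Ioi_mem_nhds ha] with b hb
      have hb0 : b ≠ 0 := (show (0 : ℝ) < b from hb).ne'
      have := ((hasDerivAt_pow (n + 1) b).div_const ((n + 1).factorial : ℝ)).fun_mul
        (Real.hasDerivAt_log hb0)
      rw [this.deriv, Nat.factorial_succ]
      push_cast
      field_simp
      ring
    have hp : (fun b : ℝ => (n + 1 : ℝ)⁻¹ * (b ^ n / n.factorial)) =
        fun b => ((n + 1 : ℝ)⁻¹ * (n.factorial : ℝ)⁻¹) * b ^ n := by
      ext b; ring
    rw [iteratedDeriv_succ', hd.iteratedDeriv_eq, iteratedDeriv_fun_add, ih ha, hp,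
      iteratedDeriv_const_mul_field, iteratedDeriv_pow, harmonic_succ]
    · simp [Nat.descFactorial_self]
      field_simp
      ring
    · exact ContDiffAt.mul (by fun_prop) (Real.contDiffAt_log.2 ha.ne')
    · fun_prop

/-! ### Chebyshev polynomials and powers of `a + iu` -/

lemma re_inv_pow_eq_norm_mul_cos (z : ℂ) (m : ℕ) :
    ((z ^ m)⁻¹).re = (‖z‖ ^ m)⁻¹ * Real.cos (m * z.arg) ∧
      ((z ^ m)⁻¹).im = -((‖z‖ ^ m)⁻¹ * Real.sin (m * z.arg)) := by
  have h : (z ^ m)⁻¹ = (((‖z‖ ^ m)⁻¹ : ℝ) : ℂ) * Complex.exp ((-(m * z.arg) : ℝ) * Complex.I) := by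
    conv_lhs => rw [← Complex.norm_mul_exp_arg_mul_I z, mul_pow, mul_inv, ← Complex.exp_nat_mul,
      ← Complex.exp_neg]
    push_cast
    congr 2
    ring
  rw [h]
  constructor
  · rw [Complex.re_ofReal_mul, Complex.exp_ofReal_mul_I_re, Real.cos_neg]
  · rw [Complex.im_ofReal_mul, Complex.exp_ofReal_mul_I_im, Real.sin_neg, mul_neg]

lemma chebyshevT_div_eq_re (ℓ : ℕ) {a : ℝ} (ha : 0 < a) (u : ℝ) :
    (Polynomial.Chebyshev.T ℝ (2 * (ℓ : ℤ))).eval (a / Real.sqrt (u ^ 2 + a ^ 2)) /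
      (u ^ 2 + a ^ 2) ^ ℓ = ((((a : ℂ) + u * Complex.I) ^ (2 * ℓ))⁻¹).re := by
  have hz0 := ofReal_add_mul_I_ne_zero ha u
  have hsq := norm_sq_add_mul_I a u
  have hc : a / Real.sqrt (u ^ 2 + a ^ 2) = Real.cos ((a : ℂ) + u * Complex.I).arg := by
    rw [Complex.cos_arg hz0, ← hsq, Real.sqrt_sq (norm_nonneg _)]
    simp
  rw [hc, Polynomial.Chebyshev.T_real_cos, (re_inv_pow_eq_norm_mul_cos _ _).1, ← hsq, ← pow_mul]
  push_cast
  ring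

lemma chebyshevU_mul_div_eq_im (ℓ : ℕ) {a : ℝ} (ha : 0 < a) {u : ℝ} :
    (Polynomial.Chebyshev.U ℝ (2 * (ℓ : ℤ))).eval (a / Real.sqrt (u ^ 2 + a ^ 2)) *
      u / (u ^ 2 + a ^ 2) ^ (ℓ + 1) = -((((a : ℂ) + u * Complex.I) ^ (2 * ℓ + 1))⁻¹).im := by
  have hz0 := ofReal_add_mul_I_ne_zero ha u
  have hsq := norm_sq_add_mul_I a u
  have hn := norm_ne_zero_iff.2 hz0
  have hc : a / Real.sqrt (u ^ 2 + a ^ 2) = Real.cos ((a : ℂ) + u * Complex.I).arg := by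
    rw [Complex.cos_arg hz0, ← hsq, Real.sqrt_sq (norm_nonneg _)]
    simp
  -- The factor u supplies the sin θ that turns U_{2ℓ}(cos θ) into sin((2ℓ+1)θ), so no division by
  -- sin θ occurs and u = 0 needs no separate case.
  have hs : u = ‖(a : ℂ) + u * Complex.I‖ * Real.sin ((a : ℂ) + u * Complex.I).arg := by
    rw [Complex.norm_mul_sin_arg]; simp
  have hU := Polynomial.Chebyshev.U_real_cos ((a : ℂ) + u * Complex.I).arg (2 * (ℓ : ℤ))
  rw [hc, (re_inv_pow_eq_norm_mul_cos _ _).2, ← hsq, ← pow_mul, neg_neg]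
  push_cast at hU ⊢
  rw [← hU]
  set v := ((a : ℂ) + u * Complex.I).arg
  set r := ‖(a : ℂ) + u * Complex.I‖
  conv_lhs => enter [1, 2]; rw [hs]
  field_simp
  ring

/-! ### The digamma function on the positive axis -/

lemma hasDerivAt_Gamma {a : ℝ} (ha : 0 < a) :
    HasDerivAt Real.Gamma (Real.Gamma a * digamma a) a := by
  have h : DifferentiableAt ℝ Real.Gamma a :=
    Real.differentiableAt_Gamma fun m => by have := m.cast_nonneg (α := ℝ); linarith
  refine h.hasDerivAt.congr_deriv ?_
  rw [digamma, mul_div_cancel₀ _ (Real.Gamma_pos_of_pos ha).ne']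

lemma hasDerivAt_log_Gamma {a : ℝ} (ha : 0 < a) :
    HasDerivAt (Real.log ∘ Real.Gamma) (digamma a) a := by
  have hG := (Real.Gamma_pos_of_pos ha).ne'
  exact ((Real.hasDerivAt_log hG).comp a (hasDerivAt_Gamma ha)).congr_deriv (by field_simp)

lemma log_Gamma_add_one {a : ℝ} (ha : 0 < a) :
    Real.log (Real.Gamma (a + 1)) = Real.log a + Real.log (Real.Gamma a) := by
  rw [Real.Gamma_add_one ha.ne', Real.log_mul ha.ne' (Real.Gamma_pos_of_pos ha).ne']

lemma digamma_add_one {a : ℝ} (ha : 0 < a) : digamma (a + 1) = digamma a + a⁻¹ := by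
  have h1 : HasDerivAt (fun b => Real.log (Real.Gamma (b + 1))) (digamma (a + 1)) a :=
    HasDerivAt.comp_add_const a 1 (hasDerivAt_log_Gamma (by linarith : 0 < a + 1))
  have h2 := (Real.hasDerivAt_log ha.ne').add (hasDerivAt_log_Gamma ha)
  have h3 : HasDerivAt (fun b => Real.log (Real.Gamma (b + 1))) (a⁻¹ + digamma a) a :=
    h2.congr_of_eventuallyEq (by
      filter_upwards [Ioi_mem_nhds ha] with b hb using log_Gamma_add_one hb)
  rw [h1.unique h3, add_comm]

/-- By convexity of log Γ, its derivative at a is at most the slope over [a, a + 1], which is log a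
by the functional equation. The companion lower bound uses the derivative at a + 1. -/
lemma digamma_le_log {a : ℝ} (ha : 0 < a) : digamma a ≤ Real.log a := by
  have h := Real.convexOn_log_Gamma.le_slope_of_hasDerivAt (mem_Ioi.2 ha)
    (mem_Ioi.2 (by linarith : 0 < a + 1)) (by linarith) (hasDerivAt_log_Gamma ha)
  rw [slope_def_field] at h
  simpa [log_Gamma_add_one ha] using h

lemma log_sub_inv_le_digamma {a : ℝ} (ha : 0 < a) : Real.log a - a⁻¹ ≤ digamma a := by
  have h := Real.convexOn_log_Gamma.slope_le_of_hasDerivAt (mem_Ioi.2 ha)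
    (mem_Ioi.2 (by linarith : 0 < a + 1)) (by linarith)
    (hasDerivAt_log_Gamma (by linarith : 0 < a + 1))
  rw [slope_def_field, digamma_add_one ha] at h
  simp [log_Gamma_add_one ha] at h
  linarith

/-- Logarithmic derivative of Legendre's duplication formula. -/
lemma digamma_add_digamma_add_half {a : ℝ} (ha : 0 < a) :
    digamma a + digamma (a + 1 / 2) = 2 * digamma (2 * a) - 2 * Real.log 2 := by
  have h1 : HasDerivAt (fun b => Real.log (Real.Gamma b) + Real.log (Real.Gamma (b + 1 / 2)))
      (digamma a + digamma (a + 1 / 2)) a :=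
    (hasDerivAt_log_Gamma ha).add
      (HasDerivAt.comp_add_const a (1 / 2) (hasDerivAt_log_Gamma (by linarith : 0 < a + 1 / 2)))
  have h2 : HasDerivAt (fun b => Real.log (Real.Gamma (2 * b)) + (1 - 2 * b) * Real.log 2 +
      Real.log (Real.sqrt Real.pi)) (2 * digamma (2 * a) - 2 * Real.log 2) a := by
    have h3 : HasDerivAt (fun b : ℝ => 2 * b) 2 a := by
      simpa using (hasDerivAt_id a).const_mul (2 : ℝ)
    have h4 := HasDerivAt.comp a (hasDerivAt_log_Gamma (by linarith : 0 < 2 * a)) h3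
    have h5 := (h3.const_sub 1).mul_const (Real.log 2)
    exact ((h4.add h5).add_const _).congr_deriv (by ring)
  refine h1.unique (h2.congr_of_eventuallyEq ?_)
  filter_upwards [Ioi_mem_nhds ha] with b hb
  have hb0 : 0 < b := hb
  have e1 := (Real.Gamma_pos_of_pos hb0).ne'
  have e2 := (Real.Gamma_pos_of_pos (by linarith : 0 < b + 1 / 2)).ne'
  have e3 := (Real.Gamma_pos_of_pos (by linarith : 0 < 2 * b)).ne'
  rw [← Real.log_mul e1 e2, Real.Gamma_mul_Gamma_add_half, Real.log_mul (by positivity)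
    (by positivity), Real.log_mul e3 (by positivity), Real.log_rpow two_pos]

/-! ### The kernel integral for `w = 1`, and comparison with the logarithm -/

lemma kernelIntegral_one {a : ℝ} (ha : 0 < a) : kernelIntegral (fun _ => 1) a = Real.log a := by
  have hd : ∀ u ∈ Ici (0 : ℝ), HasDerivAt
      (fun u => (Real.log (u ^ 2 + 1) - Real.log (u ^ 2 + a ^ 2)) / 2)
      (kernel (fun _ => 1) 0 a u) u := by
    intro u _
    have e1 : 0 < u ^ 2 + 1 := by positivity
    have e2 : 0 < u ^ 2 + a ^ 2 := by positivity
    have h1 := ((hasDerivAt_pow 2 u).add_const 1).log e1.ne'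
    have h2 := ((hasDerivAt_pow 2 u).add_const (a ^ 2)).log e2.ne'
    refine ((h1.sub h2).div_const 2).congr_deriv ?_
    rw [kernel, poleDeriv_zero, if_pos rfl]
    push_cast
    field_simp
  have ht : Tendsto (fun u : ℝ => (Real.log (u ^ 2 + 1) - Real.log (u ^ 2 + a ^ 2)) / 2) atTop
      (𝓝 0) := by
    have h1 : Tendsto (fun u : ℝ => 1 + (1 - a ^ 2) * (u ^ 2 + a ^ 2)⁻¹) atTop (𝓝 1) := by
      have : Tendsto (fun u : ℝ => (u ^ 2 + a ^ 2)⁻¹) atTop (𝓝 0) :=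
        tendsto_inv_atTop_zero.comp
          (tendsto_atTop_add_const_right _ _ (tendsto_pow_atTop two_ne_zero))
      simpa using (this.const_mul (1 - a ^ 2)).const_add 1
    have h2 := ((Real.continuousAt_log one_ne_zero).tendsto.comp h1).div_const 2
    rw [Real.log_one, zero_div] at h2
    refine h2.congr fun u => ?_
    have e1 : 0 < u ^ 2 + 1 := by positivity
    have e2 : 0 < u ^ 2 + a ^ 2 := by positivity
    rw [← Real.log_div e1.ne' e2.ne', Function.comp]
    congr 2
    field_simp
    ring
  rw [kernelIntegral, integral_Ioi_of_hasDerivAt_of_tendsto' hd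
    (integrableOn_kernel_zero measurable_const (C := 0) (by simp) ha) ht]
  simp
  ring

section

variable {w : ℝ → ℝ} {C : ℝ}

lemma integrableOn_mul_div_sq_add_sq (hw : Measurable w)
    (hC : ∀ u, 0 < u → |u * (w u - 1)| ≤ C) {a : ℝ} (ha : 0 < a) :
    IntegrableOn (fun u => u * (w u - 1) * (u ^ 2 + a ^ 2)⁻¹) (Ioi 0) := by
  refine Integrable.mono' (((integrable_inv_sq_add_sq ha).const_mul C).integrableOn)
    (by fun_prop) ?_
  filter_upwards [ae_restrict_mem measurableSet_Ioi] with u hu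
  rw [Real.norm_eq_abs, abs_mul, abs_of_pos (by positivity : 0 < (u ^ 2 + a ^ 2)⁻¹)]
  gcongr
  exact hC u hu

lemma kernelIntegral_eq_log_sub (hw : Measurable w)
    (hC : ∀ u, 0 < u → |u * (w u - 1)| ≤ C) {a : ℝ} (ha : 0 < a) :
    kernelIntegral w a =
      Real.log a - ∫ u in Ioi (0 : ℝ), u * (w u - 1) * (u ^ 2 + a ^ 2)⁻¹ := by
  rw [← kernelIntegral_one ha, kernelIntegral, kernelIntegral, ← integral_sub
    (integrableOn_kernel_zero measurable_const (C := 0) (by simp) ha)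
    (integrableOn_mul_div_sq_add_sq hw hC ha)]
  congr 1
  ext u
  simp only [kernel, poleDeriv_zero]
  ring

/-- Supplies the asymptotics at infinity that single out ψ among the solutions of its difference
equation. -/
lemma abs_kernelIntegral_sub_log_le (hw : Measurable w)
    (hC : ∀ u, 0 < u → |u * (w u - 1)| ≤ C) {a : ℝ} (ha : 0 < a) :
    |kernelIntegral w a - Real.log a| ≤ C * (Real.pi / (2 * a)) := by
  rw [kernelIntegral_eq_log_sub hw hC ha, ← integral_inv_sq_add_sq ha, ← integral_const_mul]
  rw [sub_sub_cancel_left, abs_neg, ← Real.norm_eq_abs]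
  refine MeasureTheory.norm_integral_le_of_norm_le ((integrable_inv_sq_add_sq ha).const_mul C).integrableOn ?_
  filter_upwards [ae_restrict_mem measurableSet_Ioi] with u hu
  rw [Real.norm_eq_abs, abs_mul, abs_of_pos (by positivity : 0 < (u ^ 2 + a ^ 2)⁻¹)]
  gcongr
  exact hC u hu

end

/-! ### The hyperbolic weights -/

lemma measurable_tanh_pi_mul : Measurable fun u : ℝ => Real.tanh (Real.pi * u) := by
  simp_rw [Real.tanh_eq_sinh_div_cosh]
  fun_prop

lemma measurable_inv_tanh_pi_mul : Measurable fun u : ℝ => (Real.tanh (Real.pi * u))⁻¹ :=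
  measurable_tanh_pi_mul.inv

lemma abs_mul_inv_tanh_sub_one_le (u : ℝ) (hu : 0 < u) :
    |u * ((Real.tanh (Real.pi * u))⁻¹ - 1)| ≤ 1 := by
  set x := Real.pi * u with hx
  have hx0 : 0 < x := by positivity
  have hs : 0 < Real.sinh x := Real.sinh_pos_iff.2 hx0
  have hsx : x ≤ Real.sinh x := Real.self_le_sinh_iff.2 hx0.le
  have h : u * ((Real.tanh x)⁻¹ - 1) = u * Real.exp (-x) / Real.sinh x := by
    rw [Real.tanh_eq_sinh_div_cosh, ← Real.cosh_sub_sinh]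
    field_simp
  have he : Real.exp (-x) ≤ 1 := Real.exp_le_one_iff.2 (by linarith)
  have hux : u ≤ x := by nlinarith [Real.pi_gt_three]
  rw [h, abs_of_pos (by positivity), div_le_one hs]
  calc u * Real.exp (-x) ≤ u * 1 := by gcongr
    _ ≤ Real.sinh x := by linarith

lemma abs_mul_tanh_sub_one_le (u : ℝ) (hu : 0 < u) :
    |u * (Real.tanh (Real.pi * u) - 1)| ≤ 1 := by
  set x := Real.pi * u with hx
  have hx0 : 0 < x := by positivity
  have hc : 0 < Real.cosh x := Real.cosh_pos x
  have h : u * (Real.tanh x - 1) = -(u * Real.exp (-x) / Real.cosh x) := by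
    rw [Real.tanh_eq_sinh_div_cosh, ← Real.cosh_sub_sinh]
    field_simp
    ring
  have he : Real.exp (-x) ≤ 1 := Real.exp_le_one_iff.2 (by linarith)
  have hux : u ≤ x := by nlinarith [Real.pi_gt_three]
  have hsx : x ≤ Real.sinh x := Real.self_le_sinh_iff.2 hx0.le
  rw [h, abs_neg, abs_of_pos (by positivity), div_le_one hc]
  calc u * Real.exp (-x) ≤ u * 1 := by gcongr
    _ ≤ Real.cosh x := by linarith [Real.sinh_lt_cosh x]

/-! ### Partial fractions of coth and the kernel integrals for coth and tanh -/

/-- The Mittag-Leffler series of the cotangent, taken at iu. -/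
lemma hasSum_mul_inv_tanh {u : ℝ} (hu : 0 < u) :
    HasSum (fun n : ℕ => 2 / Real.pi * (u ^ 2 / ((u ^ 2 + (n + 1 : ℝ) ^ 2))))
      (u * (Real.tanh (Real.pi * u))⁻¹ - 1 / Real.pi) := by
  have hx : (u * Complex.I : ℂ) ∈ Complex.integerComplement := by
    rintro ⟨n, hn⟩
    have := congrArg Complex.im hn
    simp at this
    exact hu.ne this
  have h := (summable_cotTerm hx).hasSum
  have hs : 0 < Real.sinh (Real.pi * u) := Real.sinh_pos_iff.2 (by positivity)
  have hcot : Complex.cot (Real.pi * (u * Complex.I)) =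
      -Complex.I * ((Real.tanh (Real.pi * u))⁻¹ : ℝ) := by
    have hs' : Complex.sinh (Real.pi * u) ≠ 0 := by exact_mod_cast hs.ne'
    rw [Complex.cot, ← mul_assoc, Complex.cos_mul_I, Complex.sin_mul_I,
      Real.tanh_eq_sinh_div_cosh]
    push_cast
    field_simp
    simp
  have hsum : ∑' n, cotTerm (u * Complex.I) n =
      Real.pi * Complex.cot (Real.pi * (u * Complex.I)) - 1 / (u * Complex.I) :=
    (cot_series_rep' hx).symm
  rw [hsum, hcot] at h
  have h' := h.mul_left (Complex.I * u / Real.pi)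
  have hu' : (u : ℂ) ≠ 0 := by exact_mod_cast hu.ne'
  have hpi : (Real.pi : ℂ) ≠ 0 := by exact_mod_cast Real.pi_ne_zero
  have hterm : ∀ n : ℕ, Complex.I * u / Real.pi * cotTerm (u * Complex.I) n =
      ((2 / Real.pi * (u ^ 2 / ((u ^ 2 + (n + 1 : ℝ) ^ 2))) : ℝ) : ℂ) := by
    intro n
    have hne : ((u : ℂ) ^ 2 + (n + 1) ^ 2) ≠ 0 := by
      have : (0 : ℝ) < u ^ 2 + (n + 1) ^ 2 := by positivity
      exact_mod_cast this.ne'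
    have : ((u * Complex.I + (n + 1)) * (u * Complex.I - (n + 1)) : ℂ) =
        -((u : ℂ) ^ 2 + (n + 1) ^ 2) := by
      linear_combination (u : ℂ) ^ 2 * Complex.I_sq
    rw [cotTerm_identity hx, this]
    push_cast
    field_simp
    linear_combination (-1 : ℂ) * Complex.I_sq
  have hval : Complex.I * u / Real.pi * (Real.pi * (-Complex.I * ((Real.tanh (Real.pi * u))⁻¹ : ℝ))
      - 1 / (u * Complex.I)) = ((u * (Real.tanh (Real.pi * u))⁻¹ - 1 / Real.pi : ℝ) : ℂ) := by
    generalize Real.tanh (Real.pi * u) = t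
    have hI := Complex.I_ne_zero
    push_cast
    generalize (t : ℂ)⁻¹ = t'
    field_simp
    linear_combination (-(Real.pi * u * t') : ℂ) * Complex.I_sq
  rw [hval] at h'
  simp_rw [hterm] at h'
  exact Complex.hasSum_ofReal.1 h'

lemma integrable_sq_div_mul {k a : ℝ} (ha : 0 < a) :
    Integrable (fun u : ℝ => u ^ 2 / (u ^ 2 + k ^ 2) * (u ^ 2 + a ^ 2)⁻¹) := by
  refine (integrable_inv_sq_add_sq ha).mono' (by fun_prop) (Eventually.of_forall fun u => ?_)
  rw [Real.norm_eq_abs, abs_of_nonneg (by positivity)]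
  refine mul_le_of_le_one_left (by positivity) (div_le_one_of_le₀ (by nlinarith) (by positivity))

lemma integral_sq_div_mul {k a : ℝ} (hk : 0 < k) (ha : 0 < a) :
    ∫ u in Ioi (0 : ℝ), u ^ 2 / (u ^ 2 + k ^ 2) * (u ^ 2 + a ^ 2)⁻¹ =
      Real.pi / (2 * (a + k)) := by
  -- Partial fractions in u² degenerate when k = a; that case has its own antiderivative.
  rcases eq_or_ne k a with rfl | hka
  · have hd : ∀ u ∈ Ici (0 : ℝ), HasDerivAt
        (fun u => (2 * k)⁻¹ * Real.arctan (k⁻¹ * u) - u / (2 * (u ^ 2 + k ^ 2)))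
        (u ^ 2 / (u ^ 2 + k ^ 2) * (u ^ 2 + k ^ 2)⁻¹) u := by
      intro u _
      have e1 : 0 < u ^ 2 + k ^ 2 := by positivity
      have e2 : 0 < 1 + (k⁻¹ * u) ^ 2 := by positivity
      have h1 := (((hasDerivAt_id u).const_mul k⁻¹).arctan).const_mul (2 * k)⁻¹
      have h2 := (hasDerivAt_id u).div (((hasDerivAt_pow 2 u).add_const (k ^ 2)).const_mul 2)
        (by positivity)
      refine (h1.sub h2).congr_deriv ?_
      simp only [id]
      push_cast
      have e3 : (1 + (k⁻¹ * u) ^ 2) = (u ^ 2 + k ^ 2) / k ^ 2 := by field_simp; ring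
      rw [e3]
      field_simp
      ring
    have ht : Tendsto (fun u : ℝ => (2 * k)⁻¹ * Real.arctan (k⁻¹ * u) - u / (2 * (u ^ 2 + k ^ 2)))
        atTop (𝓝 ((2 * k)⁻¹ * (Real.pi / 2) - 0)) := by
      refine Tendsto.sub (Tendsto.const_mul _ ?_) ?_
      · exact (tendsto_nhds_of_tendsto_nhdsWithin Real.tendsto_arctan_atTop).comp
          (tendsto_id.const_mul_atTop (inv_pos.2 ha))
      · refine squeeze_zero' ?_ ?_ tendsto_inv_atTop_zero
        · filter_upwards [eventually_ge_atTop 0] with u hu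
          positivity
        · filter_upwards [eventually_gt_atTop 0] with u hu
          rw [div_le_iff₀ (by positivity), inv_mul_eq_div, le_div_iff₀ hu]
          nlinarith
    rw [integral_Ioi_of_hasDerivAt_of_tendsto' hd (integrable_sq_div_mul ha).integrableOn ht]
    simp
    field_simp
    ring
  · have h2 : k ^ 2 - a ^ 2 ≠ 0 := by
      rw [sq_sub_sq]
      exact mul_ne_zero (by positivity) (sub_ne_zero.2 hka)
    have h : ∀ u : ℝ, u ^ 2 / (u ^ 2 + k ^ 2) * (u ^ 2 + a ^ 2)⁻¹ =
        k ^ 2 / (k ^ 2 - a ^ 2) * (u ^ 2 + k ^ 2)⁻¹ -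
          a ^ 2 / (k ^ 2 - a ^ 2) * (u ^ 2 + a ^ 2)⁻¹ := by
      intro u
      have e1 : 0 < u ^ 2 + k ^ 2 := by positivity
      have e2 : 0 < u ^ 2 + a ^ 2 := by positivity
      field_simp
      ring
    simp_rw [h]
    rw [integral_sub ((integrable_inv_sq_add_sq hk).const_mul _).integrableOn
      ((integrable_inv_sq_add_sq ha).const_mul _).integrableOn, integral_const_mul,
      integral_const_mul, integral_inv_sq_add_sq hk, integral_inv_sq_add_sq ha]
    field_simp
    ring

lemma hasSum_inv_add_sub_inv_add {a : ℝ} (ha : 0 < a) :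
    HasSum (fun n : ℕ => (a + n)⁻¹ - (a + n + 1)⁻¹) a⁻¹ := by
  rw [hasSum_iff_tendsto_nat_of_nonneg]
  · have h : ∀ n : ℕ, ∑ i ∈ Finset.range n, ((a + i)⁻¹ - (a + i + 1)⁻¹) = a⁻¹ - (a + n)⁻¹ := by
      intro n
      have := Finset.sum_range_sub' (fun i : ℕ => (a + i)⁻¹) n
      simpa [add_assoc] using this
    simp_rw [h]
    have : Tendsto (fun n : ℕ => (a + n)⁻¹) atTop (𝓝 0) :=
      tendsto_inv_atTop_zero.comp (tendsto_atTop_add_const_left _ _ tendsto_natCast_atTop_atTop)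
    simpa using this.const_sub a⁻¹
  · intro n
    rw [sub_nonneg]
    exact inv_anti₀ (by positivity) (by linarith)

/-- The functional equation of the kernel integral with weight `coth (π u)`. -/
lemma kernelIntegral_coth_add_one {a : ℝ} (ha : 0 < a) :
    kernelIntegral (fun u => (Real.tanh (Real.pi * u))⁻¹) (a + 1) =
      kernelIntegral (fun u => (Real.tanh (Real.pi * u))⁻¹) a + (a⁻¹ + (a + 1)⁻¹) / 2 := by
  have hb : 0 < a + 1 := by linarith
  have hint := fun {c : ℝ} (hc : 0 < c) => integrableOn_kernel_zero measurable_inv_tanh_pi_mul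
    abs_mul_inv_tanh_sub_one_le hc
  -- For a single a the integrated series is a divergent sum of 1/(a + n + 1). The difference
  -- between a and a + 1 has nonnegative terms whose integrals telescope to 1/(a + 1).
  set g : ℕ → ℝ → ℝ := fun n u => 2 / Real.pi * (u ^ 2 / (u ^ 2 + (n + 1 : ℝ) ^ 2)) *
    ((u ^ 2 + a ^ 2)⁻¹ - (u ^ 2 + (a + 1) ^ 2)⁻¹) with hg
  have hg' : ∀ n, g n = fun u => 2 / Real.pi * (u ^ 2 / (u ^ 2 + (n + 1 : ℝ) ^ 2) *
      (u ^ 2 + a ^ 2)⁻¹ - u ^ 2 / (u ^ 2 + (n + 1 : ℝ) ^ 2) * (u ^ 2 + (a + 1) ^ 2)⁻¹) := by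
    intro n; ext u; rw [hg]; ring
  have hg0 : ∀ n u, 0 ≤ g n u := by
    intro n u
    have : (u ^ 2 + (a + 1) ^ 2)⁻¹ ≤ (u ^ 2 + a ^ 2)⁻¹ := by gcongr; linarith
    have := sub_nonneg.2 this
    rw [hg]
    positivity
  have hgi : ∀ n, IntegrableOn (g n) (Ioi 0) := by
    intro n
    rw [hg' n]
    exact (((integrable_sq_div_mul ha).sub (integrable_sq_div_mul hb)).const_mul _).integrableOn
  have hgint : ∀ n, ∫ u in Ioi (0 : ℝ), g n u = (a + 1 + n)⁻¹ - (a + 1 + n + 1)⁻¹ := by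
    intro n
    have hn : (0 : ℝ) < n + 1 := by positivity
    rw [hg' n, integral_const_mul, integral_sub (integrable_sq_div_mul ha).integrableOn
      (integrable_sq_div_mul hb).integrableOn, integral_sq_div_mul hn ha,
      integral_sq_div_mul hn hb]
    have e1 : 0 < a + 1 + n := by positivity
    have e2 : 0 < a + 1 + n + 1 := by positivity
    rw [show a + (n + 1 : ℝ) = a + 1 + n by ring,
      show a + 1 + (n + 1 : ℝ) = a + 1 + n + 1 by ring]
    field_simp
  have hS := hasSum_inv_add_sub_inv_add hb
  have hsum : ∫ u in Ioi (0 : ℝ), ∑' n, g n u = (a + 1)⁻¹ := by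
    refine (hasSum_integral_of_summable_integral_norm hgi ?_).unique ?_
    · simp_rw [Real.norm_of_nonneg (hg0 _ _), hgint]
      exact hS.summable
    · simp_rw [hgint]
      exact hS
  have hDi : IntegrableOn (fun u : ℝ => (u ^ 2 + a ^ 2)⁻¹ - (u ^ 2 + (a + 1) ^ 2)⁻¹) (Ioi 0) :=
    ((integrable_inv_sq_add_sq ha).sub (integrable_inv_sq_add_sq hb)).integrableOn
  have hpt : ∀ u ∈ Ioi (0 : ℝ), ∑' n, g n u =
      (kernel (fun u => (Real.tanh (Real.pi * u))⁻¹) 0 (a + 1) u -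
        kernel (fun u => (Real.tanh (Real.pi * u))⁻¹) 0 a u) -
      1 / Real.pi * ((u ^ 2 + a ^ 2)⁻¹ - (u ^ 2 + (a + 1) ^ 2)⁻¹) := by
    intro u hu
    rw [((hasSum_mul_inv_tanh hu).mul_right
      ((u ^ 2 + a ^ 2)⁻¹ - (u ^ 2 + (a + 1) ^ 2)⁻¹)).tsum_eq]
    simp only [kernel, poleDeriv_zero]
    ring
  have hK : IntegrableOn (fun u => kernel (fun u => (Real.tanh (Real.pi * u))⁻¹) 0 (a + 1) u -
      kernel (fun u => (Real.tanh (Real.pi * u))⁻¹) 0 a u) (Ioi 0) := (hint hb).sub (hint ha)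
  rw [setIntegral_congr_fun measurableSet_Ioi hpt, integral_sub hK (hDi.const_mul _), integral_sub (hint hb) (hint ha), integral_const_mul, integral_sub
    (integrable_inv_sq_add_sq ha).integrableOn (integrable_inv_sq_add_sq hb).integrableOn,
    integral_inv_sq_add_sq ha, integral_inv_sq_add_sq hb] at hsum
  have hpi := Real.pi_ne_zero
  have e : 1 / Real.pi * (Real.pi / (2 * a) - Real.pi / (2 * (a + 1))) =
      (a⁻¹ - (a + 1)⁻¹) / 2 := by
    field_simp
  rw [e] at hsum
  simp only [kernelIntegral]
  linarith

/-- Both sides satisfy the same difference equation, so their difference has period 1; both are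
within O(1/a) of log a, so it tends to 0 along a + n and vanishes. -/
theorem kernelIntegral_coth {a : ℝ} (ha : 0 < a) :
    kernelIntegral (fun u => (Real.tanh (Real.pi * u))⁻¹) a = digamma a + 1 / (2 * a) := by
  set F := kernelIntegral (fun u => (Real.tanh (Real.pi * u))⁻¹) with hF
  set g : ℝ → ℝ := fun b => F b - digamma b - b⁻¹ / 2 with hg
  have hper : ∀ n : ℕ, g (a + n) = g a := by
    intro n
    induction n with
    | zero => simp
    | succ n ih =>
      have han : 0 < a + n := by positivity
      rw [← ih]
      simp only [hg]
      push_cast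
      rw [← add_assoc, digamma_add_one han, hF, kernelIntegral_coth_add_one han]
      ring
  -- π/2 comes from comparing the kernel integral with log, 1 from comparing ψ with log, and 1/2
  -- from the term 1/(2b).
  have hbound : ∀ b, 0 < b → |g b| ≤ (Real.pi / 2 + 3 / 2) * b⁻¹ := by
    intro b hb
    have h1 := abs_le.1 (abs_kernelIntegral_sub_log_le measurable_inv_tanh_pi_mul
      abs_mul_inv_tanh_sub_one_le hb)
    have h2 := digamma_le_log hb
    have h3 := log_sub_inv_le_digamma hb
    have h4 : 0 < b⁻¹ := inv_pos.2 hb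
    have h5 : 1 * (Real.pi / (2 * b)) = Real.pi / 2 * b⁻¹ := by field_simp
    rw [h5, ← hF] at h1
    rw [abs_le]
    constructor <;> simp only [hg] <;> nlinarith [h1.1, h1.2]
  have hlim : Tendsto (fun n : ℕ => (Real.pi / 2 + 3 / 2) * (a + n)⁻¹) atTop (𝓝 0) := by
    have : Tendsto (fun n : ℕ => (a + n)⁻¹) atTop (𝓝 0) :=
      tendsto_inv_atTop_zero.comp (tendsto_atTop_add_const_left _ _ tendsto_natCast_atTop_atTop)
    simpa using this.const_mul (Real.pi / 2 + 3 / 2)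
  have h0 : |g a| ≤ 0 := ge_of_tendsto' hlim fun n => by
    rw [← hper n]; exact hbound _ (by positivity)
  have h0' := abs_nonpos_iff.1 h0
  simp only [hg] at h0'
  rw [one_div, mul_inv]
  linarith

lemma two_mul_inv_tanh_two_mul_sub {x : ℝ} (hx : 0 < x) :
    2 * (Real.tanh (2 * x))⁻¹ - (Real.tanh x)⁻¹ = Real.tanh x := by
  have hs := Real.sinh_pos_iff.2 hx
  have hc := Real.cosh_pos x
  rw [Real.tanh_eq_sinh_div_cosh, Real.tanh_eq_sinh_div_cosh, Real.sinh_two_mul, Real.cosh_two_mul]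
  field_simp
  ring

/-- Since tanh x = 2 coth 2x - coth x, rescaling u by 2 reduces to the coth integral at 2a and at a;
the duplication formula for ψ finishes. -/
theorem kernelIntegral_tanh {a : ℝ} (ha : 0 < a) :
    kernelIntegral (fun u => Real.tanh (Real.pi * u)) a = digamma (a + 1 / 2) := by
  have h2a : 0 < 2 * a := by linarith
  have hm := measurable_inv_tanh_pi_mul
  have hC := abs_mul_inv_tanh_sub_one_le
  have h1 := kernelIntegral_eq_log_sub hm hC ha
  have h2 := kernelIntegral_eq_log_sub hm hC h2a
  have h3 := kernelIntegral_eq_log_sub measurable_tanh_pi_mul abs_mul_tanh_sub_one_le ha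
  have hsub := integral_comp_mul_left_Ioi (fun u : ℝ =>
    u * ((Real.tanh (Real.pi * u))⁻¹ - 1) * (u ^ 2 + (2 * a) ^ 2)⁻¹) 0 two_pos
  have hi : IntegrableOn (fun u : ℝ => u * (((Real.tanh (Real.pi * (2 * u)))⁻¹) - 1) *
      (u ^ 2 + a ^ 2)⁻¹) (Ioi 0) := by
    refine integrableOn_mul_div_sq_add_sq (C := 1) (hm.comp (measurable_const_mul 2))
      (fun u hu => ?_) ha
    have := hC (2 * u) (by linarith)
    rw [mul_assoc, abs_mul, abs_of_pos (two_pos : (0 : ℝ) < 2)] at this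
    simp only [Function.comp]
    linarith [abs_nonneg (u * ((Real.tanh (Real.pi * (2 * u)))⁻¹ - 1))]
  have hpt : ∀ u ∈ Ioi (0 : ℝ), u * (Real.tanh (Real.pi * u) - 1) * (u ^ 2 + a ^ 2)⁻¹ =
      2 * (u * ((Real.tanh (Real.pi * (2 * u)))⁻¹ - 1) * (u ^ 2 + a ^ 2)⁻¹) -
        u * ((Real.tanh (Real.pi * u))⁻¹ - 1) * (u ^ 2 + a ^ 2)⁻¹ := by
    intro u hu
    have hu0 : 0 < u := hu
    have := two_mul_inv_tanh_two_mul_sub (x := Real.pi * u) (by positivity)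
    rw [show Real.pi * (2 * u) = 2 * (Real.pi * u) by ring]
    linear_combination (-(u * (u ^ 2 + a ^ 2)⁻¹)) * this
  have hscale : ∀ u : ℝ, 2 * u * ((Real.tanh (Real.pi * (2 * u)))⁻¹ - 1) *
      ((2 * u) ^ 2 + (2 * a) ^ 2)⁻¹ =
        2⁻¹ * (u * ((Real.tanh (Real.pi * (2 * u)))⁻¹ - 1) * (u ^ 2 + a ^ 2)⁻¹) := by
    intro u
    have e : 0 < u ^ 2 + a ^ 2 := by positivity
    rw [show (2 * u) ^ 2 + (2 * a) ^ 2 = 4 * (u ^ 2 + a ^ 2) by ring, mul_inv]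
    ring
  simp_rw [hscale] at hsub
  rw [integral_const_mul, mul_zero, smul_eq_mul] at hsub
  rw [setIntegral_congr_fun measurableSet_Ioi hpt, integral_sub (hi.const_mul 2)
    (integrableOn_mul_div_sq_add_sq hm hC ha), integral_const_mul] at h3
  rw [kernelIntegral_coth ha] at h1
  rw [kernelIntegral_coth h2a, Real.log_mul two_ne_zero ha.ne'] at h2
  have hd := digamma_add_digamma_add_half ha
  have e : 2 * (1 / (2 * (2 * a))) = 1 / (2 * a) := by field_simp
  linarith

/-! ### The binomial coefficient as a monic polynomial -/

/-- `∏_{k < n} (X + s - 1 - k)`, which is `n!` times the binomial coefficient of `X + s - 1`. -/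
noncomputable def shiftedFalling (s : ℝ) (n : ℕ) : Polynomial ℝ :=
  ∏ k ∈ Finset.range n, (Polynomial.X + Polynomial.C (s - 1 - k))

lemma shiftedFalling_monic (s : ℝ) (n : ℕ) : (shiftedFalling s n).Monic :=
  Polynomial.monic_prod_of_monic _ _ fun _ _ => Polynomial.monic_X_add_C _

lemma natDegree_shiftedFalling (s : ℝ) (n : ℕ) : (shiftedFalling s n).natDegree = n := by
  rw [shiftedFalling, Polynomial.natDegree_prod_of_monic _ _
    fun _ _ => Polynomial.monic_X_add_C _]
  simp only [Polynomial.natDegree_X_add_C]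
  simp

lemma choose_eq_eval_shiftedFalling (s b : ℝ) (n : ℕ) :
    Ring.choose (b + s - 1) n = (shiftedFalling s n).eval b / n.factorial := by
  rw [Ring.choose_eq_smul, ← Polynomial.aeval_eq_smeval, Polynomial.aeval_def,
    ← Polynomial.eval_map, descPochhammer_map, descPochhammer_eval_eq_prod_range, shiftedFalling,
    Polynomial.eval_prod, smul_eq_mul, inv_mul_eq_div]
  congr 1
  refine Finset.prod_congr rfl fun k _ => ?_
  simp
  ring

/-- The factors are v + m, ..., v - m; induction strips the two outer ones, whose product is a
difference of squares. -/
lemma prod_range_shift_odd (v : ℂ) (m : ℕ) :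
    ∏ k ∈ Finset.range (2 * m + 1), (v + ((m + 1 : ℕ) - 1 - k)) =
      v * ∏ j ∈ Finset.Icc 1 m, (v ^ 2 - (j : ℂ) ^ 2) := by
  induction m with
  | zero => simp
  | succ m ih =>
    rw [show 2 * (m + 1) + 1 = 2 * m + 1 + 1 + 1 by ring, Finset.prod_range_succ,
      Finset.prod_range_succ', Finset.prod_Icc_succ_top (by omega), ← mul_assoc, ← ih,
      Finset.prod_congr rfl (g := fun k : ℕ => v + (((m + 1 : ℕ) : ℂ) - 1 - k))
        fun k _ => by push_cast; ring]
    push_cast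
    ring

lemma prod_range_shift_even (v : ℂ) (m : ℕ) :
    ∏ k ∈ Finset.range (2 * m), (v + (m + 1 / 2 - 1 - k)) =
      ∏ j ∈ Finset.Icc 1 m, (v ^ 2 - ((j : ℂ) - 1 / 2) ^ 2) := by
  induction m with
  | zero => simp
  | succ m ih =>
    rw [show 2 * (m + 1) = 2 * m + 1 + 1 by ring, Finset.prod_range_succ,
      Finset.prod_range_succ', Finset.prod_Icc_succ_top (by omega), ← ih,
      Finset.prod_congr rfl (g := fun k : ℕ => v + ((m : ℂ) + 1 / 2 - 1 - k))
        fun k _ => by push_cast; ring]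
    push_cast
    ring

lemma aeval_shiftedFalling_odd (u : ℝ) (m : ℕ) :
    Polynomial.aeval (-(u * Complex.I)) (shiftedFalling ((m + 1 : ℕ) : ℝ) (2 * m + 1)) =
      -(u * Complex.I) * ((-1) ^ m * P₁ u (m + 1) : ℝ) := by
  have h := prod_range_shift_odd (-(u * Complex.I)) m
  rw [shiftedFalling, map_prod]
  simp only [map_add, Polynomial.aeval_X, Polynomial.aeval_C, Complex.coe_algebraMap]
  push_cast at h ⊢
  rw [h, P₁, Nat.add_sub_cancel]
  congr 1
  have hc : (-1 : ℂ) ^ m = ∏ _j ∈ Finset.Icc 1 m, (-1 : ℂ) := by simp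
  rw [hc]
  push_cast
  rw [← Finset.prod_mul_distrib]
  refine Finset.prod_congr rfl fun j _ => ?_
  linear_combination (u : ℂ) ^ 2 * Complex.I_sq

lemma aeval_shiftedFalling_even (u : ℝ) (m : ℕ) :
    Polynomial.aeval (-(u * Complex.I)) (shiftedFalling ((m : ℝ) + 1 / 2) (2 * m)) =
      ((-1) ^ m * P₂ u m : ℝ) := by
  have h := prod_range_shift_even (-(u * Complex.I)) m
  rw [shiftedFalling, map_prod]
  simp only [map_add, Polynomial.aeval_X, Polynomial.aeval_C, Complex.coe_algebraMap]
  push_cast at h ⊢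
  rw [h, P₂]
  have hc : (-1 : ℂ) ^ m = ∏ _j ∈ Finset.Icc 1 m, (-1 : ℂ) := by simp
  rw [hc]
  push_cast
  rw [← Finset.prod_mul_distrib]
  refine Finset.prod_congr rfl fun j _ => ?_
  linear_combination (u : ℂ) ^ 2 * Complex.I_sq

/-! ### The two evaluations -/

lemma log_add_harmonic_eq_integral (n : ℕ) {a : ℝ} (ha : 0 < a) :
    IntegrableOn (polynomialKernel (Polynomial.X ^ n) n (fun _ => 1) a) (Ioi 0) ∧
    Real.log a + (harmonic n : ℝ) =
      ∫ u in Ioi (0 : ℝ), polynomialKernel (Polynomial.X ^ n) n (fun _ => 1) a u := by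
  have h := iteratedDeriv_monic_mul_kernelIntegral (Polynomial.monic_X_pow n)
    (Polynomial.natDegree_X_pow n) (measurable_const (a := (1 : ℝ))) (C := 0) (by simp) ha
  refine ⟨h.1, ?_⟩
  rw [← h.2, ← iteratedDeriv_pow_mul_log n ha]
  refine EventuallyEq.iteratedDeriv_eq n ?_
  filter_upwards [Ioi_mem_nhds ha] with b hb
  rw [kernelIntegral_one hb, Polynomial.eval_pow, Polynomial.eval_X]

lemma iteratedDeriv_choose_mul_digamma_odd (m : ℕ) {x : ℝ} (hx : ((m + 1 : ℕ) : ℝ) < x) :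
    iteratedDeriv (2 * m + 1) (fun y : ℝ => Ring.choose (y - 1) (2 * m + 1) *
        digamma (y - (m + 1 : ℕ))) x =
      iteratedDeriv (2 * m + 1) (fun b =>
        (shiftedFalling ((m + 1 : ℕ) : ℝ) (2 * m + 1)).eval b / (2 * m + 1).factorial *
          kernelIntegral (fun u => (Real.tanh (Real.pi * u))⁻¹) b) (x - (m + 1 : ℕ)) := by
  set s : ℝ := ((m + 1 : ℕ) : ℝ) with hs
  set M := shiftedFalling s (2 * m + 1) with hM
  have ha : 0 < x - s := sub_pos.2 hx
  -- Since M(0) = 0, the contribution M(b)/(2b) of the extra 1/(2b) in the coth integral is a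
  -- polynomial of degree at most 2m, which 2m + 1 derivatives annihilate.
  have h0 : M.coeff 0 = 0 := by
    rw [Polynomial.coeff_zero_eq_eval_zero, hM, shiftedFalling, Polynomial.eval_prod]
    refine Finset.prod_eq_zero (i := m) (Finset.mem_range.2 (by omega)) ?_
    simp [hs]
  have hdiv : ∀ b, M.eval b = b * M.divX.eval b := by
    intro b
    conv_lhs => rw [← Polynomial.divX_mul_X_add M, h0]
    simp [mul_comm]
  have hdeg : (Polynomial.C ((2 * (2 * m + 1).factorial : ℝ)⁻¹) * M.divX).natDegree <
      2 * m + 1 := by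
    refine (Polynomial.natDegree_C_mul_le _ _).trans_lt ?_
    rw [Polynomial.natDegree_divX_eq_natDegree_tsub_one, hM, natDegree_shiftedFalling]
    omega
  have hcd : ContDiffAt ℝ ((2 * m + 1 : ℕ) : WithTop ℕ∞) (fun b =>
      M.eval b / (2 * m + 1).factorial *
        kernelIntegral (fun u => (Real.tanh (Real.pi * u))⁻¹) b) (x - s) := by
    refine ContDiffAt.mul (ContDiffAt.div_const ?_ _) (contDiffAt_kernelIntegral
      measurable_inv_tanh_pi_mul abs_mul_inv_tanh_sub_one_le _ ha)
    exact (contDiff_polynomial_eval M _).contDiffAt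
  have hshift := iteratedDeriv_comp_add_const (2 * m + 1) (fun y : ℝ =>
    Ring.choose (y - 1) (2 * m + 1) * digamma (y - s)) s
  have hx' := congrFun hshift (x - s)
  rw [sub_add_cancel] at hx'
  rw [← hx', ← sub_zero (iteratedDeriv _ (fun b => M.eval b / _ * _) _),
    ← iteratedDeriv_polynomial_eval_eq_zero hdeg (x - s), ← iteratedDeriv_fun_sub hcd
      (contDiff_polynomial_eval _ _).contDiffAt]
  refine EventuallyEq.iteratedDeriv_eq _ ?_
  filter_upwards [Ioi_mem_nhds ha] with b hb
  have hb0 : b ≠ 0 := (show (0 : ℝ) < b from hb).ne'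
  rw [choose_eq_eval_shiftedFalling, kernelIntegral_coth hb, add_sub_cancel_right, ← hM,
    Polynomial.eval_C_mul, hdiv b]
  field_simp
  ring

lemma iteratedDeriv_choose_mul_digamma_even (m : ℕ) {x : ℝ} (hx : (m : ℝ) + 1 / 2 < x) :
    iteratedDeriv (2 * m) (fun y : ℝ => Ring.choose (y - 1) (2 * m) * digamma (y - m)) x =
      iteratedDeriv (2 * m) (fun b =>
        (shiftedFalling ((m : ℝ) + 1 / 2) (2 * m)).eval b / (2 * m).factorial *
          kernelIntegral (fun u => Real.tanh (Real.pi * u)) b) (x - m - 1 / 2) := by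
  have ha : 0 < x - m - 1 / 2 := by linarith
  have hshift := iteratedDeriv_comp_add_const (2 * m) (fun y : ℝ =>
    Ring.choose (y - 1) (2 * m) * digamma (y - m)) ((m : ℝ) + 1 / 2)
  have hx' := congrFun hshift (x - m - 1 / 2)
  rw [show x - m - 1 / 2 + ((m : ℝ) + 1 / 2) = x by ring] at hx'
  rw [← hx']
  refine EventuallyEq.iteratedDeriv_eq _ ?_
  filter_upwards [Ioi_mem_nhds ha] with b hb
  rw [choose_eq_eval_shiftedFalling, kernelIntegral_tanh hb]
  congr 2
  ring

/-- Here n is odd and both polynomials at -iu equal -iu times a real number, so the imaginary part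
in `polynomialKernel` becomes Re z^(-2ℓ). -/
lemma integrandT_eq (m : ℕ) {x : ℝ} (hx : ((m + 1 : ℕ) : ℝ) < x) (u : ℝ) :
    integrandT (m + 1) x u = (-1) ^ (m + 1) *
      (polynomialKernel (Polynomial.X ^ (2 * m + 1)) (2 * m + 1) (fun _ => 1)
          (x - (m + 1 : ℕ)) u -
        polynomialKernel (shiftedFalling ((m + 1 : ℕ) : ℝ) (2 * m + 1)) (2 * m + 1)
          (fun u => (Real.tanh (Real.pi * u))⁻¹) (x - (m + 1 : ℕ)) u) := by
  have hT := chebyshevT_div_eq_re (m + 1) (sub_pos.2 hx) u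
  rw [integrandT, mul_div_assoc, hT, polynomialKernel, polynomialKernel, aeval_shiftedFalling_odd]
  have e : (Polynomial.aeval (-(u * Complex.I))) (Polynomial.X ^ (2 * m + 1) : Polynomial ℝ) =
      -(u * Complex.I) * ((-1) ^ m * u ^ (2 * m) : ℝ) := by
    rw [map_pow, Polynomial.aeval_X, pow_succ, pow_mul, neg_sq, mul_pow, Complex.I_sq]
    push_cast
    rw [pow_mul, ← mul_pow]
    ring
  have key : ∀ (r : ℝ) (Z : ℂ),
      ((-1) ^ (2 * m + 1) * (-(u * Complex.I) * r) * Z).im = u * r * Z.re := by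
    intro r Z
    rw [pow_succ, pow_mul]
    simp
  rw [e, key, key, show 2 * (m + 1) - 1 = 2 * m + 1 by omega,
    show 2 * m + 1 + 1 = 2 * (m + 1) by ring]
  generalize (((((x - (m + 1 : ℕ) : ℝ) : ℂ) + u * Complex.I) ^ (2 * (m + 1)))⁻¹).re = Z
  have h1 : ((-1 : ℝ) ^ m) * (-1) ^ m = 1 := by rw [← mul_pow]; simp
  rw [pow_succ (-1 : ℝ) m, div_eq_mul_inv, pow_succ u]
  linear_combination (-((u * P₁ u (m + 1) * (Real.tanh (Real.pi * u))⁻¹ -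
    u ^ (2 * m) * u) * Z)) * h1

/-- Here n is even and both polynomials are real at -iu, so the imaginary part of z^(-(2ℓ+1))
survives. -/
lemma integrandU_eq (m : ℕ) {x : ℝ} (hx : (m : ℝ) + 1 / 2 < x) (u : ℝ) :
    integrandU m x u = (-1) ^ m *
      (polynomialKernel (Polynomial.X ^ (2 * m)) (2 * m) (fun _ => 1) (x - m - 1 / 2) u -
        polynomialKernel (shiftedFalling ((m : ℝ) + 1 / 2) (2 * m)) (2 * m)
          (fun u => Real.tanh (Real.pi * u)) (x - m - 1 / 2) u) := by
  have hU := chebyshevU_mul_div_eq_im m (by linarith : 0 < x - m - 1 / 2) (u := u)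
  rw [integrandU, mul_assoc, mul_div_assoc, hU, polynomialKernel, polynomialKernel,
    aeval_shiftedFalling_even]
  have e : (Polynomial.aeval (-(u * Complex.I))) (Polynomial.X ^ (2 * m) : Polynomial ℝ) =
      ((-1) ^ m * u ^ (2 * m) : ℝ) := by
    rw [map_pow, Polynomial.aeval_X, pow_mul, neg_sq, mul_pow, Complex.I_sq]
    push_cast
    rw [pow_mul, ← mul_pow]
    ring
  have key : ∀ (r : ℝ) (Z : ℂ), ((-1) ^ (2 * m) * (r : ℂ) * Z).im = r * Z.im := by
    intro r Z
    rw [pow_mul]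
    simp
  rw [e, key, key]
  generalize (((((x - m - 1 / 2 : ℝ) : ℂ) + u * Complex.I) ^ (2 * m + 1))⁻¹).im = Z
  have h1 : ((-1 : ℝ) ^ m) * (-1) ^ m = 1 := by rw [← mul_pow]; simp
  linear_combination ((Real.tanh (Real.pi * u) * P₂ u m - u ^ (2 * m)) * Z) * h1

end ChebyshevIntegrals

theorem mainTheorem7 :
    (∀ ℓ : ℕ, 1 ≤ ℓ → ∀ x : ℝ, (ℓ : ℝ) < x →
      MeasureTheory.IntegrableOn (ChebyshevIntegrals.integrandT ℓ x) (Set.Ioi 0) ∧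
      ∫ u in Set.Ioi (0 : ℝ), ChebyshevIntegrals.integrandT ℓ x u =
        (-1 : ℝ) ^ ℓ * (Real.log (x - ℓ) + (harmonic (2 * ℓ - 1) : ℝ) -
          iteratedDeriv (2 * ℓ - 1)
            (fun y : ℝ => Ring.choose (y - 1) (2 * ℓ - 1) *
              ChebyshevIntegrals.digamma (y - ℓ)) x)) ∧
    (∀ ℓ : ℕ, ∀ x : ℝ, (ℓ : ℝ) + 1 / 2 < x →
      MeasureTheory.IntegrableOn (ChebyshevIntegrals.integrandU ℓ x) (Set.Ioi 0) ∧
      ∫ u in Set.Ioi (0 : ℝ), ChebyshevIntegrals.integrandU ℓ x u =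
        (-1 : ℝ) ^ ℓ * (Real.log (x - ℓ - 1 / 2) + (harmonic (2 * ℓ) : ℝ) -
          iteratedDeriv (2 * ℓ)
            (fun y : ℝ => Ring.choose (y - 1) (2 * ℓ) *
              ChebyshevIntegrals.digamma (y - ℓ)) x)) := by
  open ChebyshevIntegrals in
  constructor
  · intro ℓ hℓ x hx
    obtain ⟨m, rfl⟩ := Nat.exists_eq_add_of_le' hℓ
    have ha := sub_pos.2 hx
    have h1 := log_add_harmonic_eq_integral (2 * m + 1) ha
    have h2 := iteratedDeriv_monic_mul_kernelIntegral
      (shiftedFalling_monic ((m + 1 : ℕ) : ℝ) (2 * m + 1)) (natDegree_shiftedFalling _ _)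
      measurable_inv_tanh_pi_mul abs_mul_inv_tanh_sub_one_le ha
    rw [funext (integrandT_eq m hx), show 2 * (m + 1) - 1 = 2 * m + 1 by omega,
      iteratedDeriv_choose_mul_digamma_odd m hx, h1.2, h2.2]
    refine ⟨(h1.1.sub h2.1).const_mul _, ?_⟩
    rw [integral_const_mul, integral_sub h1.1 h2.1]
  · intro ℓ x hx
    have ha : 0 < x - ℓ - 1 / 2 := by linarith
    have h1 := log_add_harmonic_eq_integral (2 * ℓ) ha
    have h2 := iteratedDeriv_monic_mul_kernelIntegral
      (shiftedFalling_monic ((ℓ : ℝ) + 1 / 2) (2 * ℓ)) (natDegree_shiftedFalling _ _)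
      measurable_tanh_pi_mul abs_mul_tanh_sub_one_le ha
    rw [funext (integrandU_eq ℓ hx), iteratedDeriv_choose_mul_digamma_even ℓ hx, h1.2, h2.2]
    refine ⟨(h1.1.sub h2.1).const_mul _, ?_⟩
    rw [integral_const_mul, integral_sub h1.1 h2.1]
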